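/- All manifolds are real, finite dimensional, smooth ($C^\infty$) and without boundary. Let $\nu:N\to M$ be a smooth fibre bundle with a smooth map $\rho:N\to TM$ fibred over the identity of $M$ (an anchored bundle), and let $\pi:P\to M$ be a principal fibre bundle with structure group a Lie group $G$, with right action $R_g(u)=ug$. Let $h:\pi^*N\to TP$ be a principal $\rho$-lift, i.e. a smooth map fibred over the identity of $P$ such that $TR_g(h(u,s))=h(ug,s)$ and $T\pi(h(u,s))=\rho(s)$ for all $(u,s)\in\pi^*N=\{(u,s)\in P\times N:\pi(u)=\nu(s)\}$ and $g\in G$. Let $Q$ be the distribution on $P$ generated by the local vector fields $h\circ\sigma$, where $\sigma$ runs over the smooth local sections of $\pi^*N\to P$; let $\widetilde Q$ be the smallest completely integrable distribution on $P$ containing $Q$, and for $u\in P$ let $H(u)$ be the leaf of $\widetilde Q$ through $u$. (A distribution $F$ assigns to each point $x$ a linear subspace $F_x$ of the tangent space, spanned by the values at $x$ of smooth vector fields lying in $F$; its rank may vary. It is completely integrable if every point lies in an integral manifold, i.e. a connected immersed submanifold $L$ with $T_yL=F_y$ for all $y\in L$; a leaf is a maximal integral manifold. The distribution $\widetilde Q$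 exists by a theorem of Sussmann.) Put $\Phi(u)=\{g\in G: ug\in H(u)\}$. Then: (1) for every $u\in P$, $\Phi(u)$ is a subgroup of $G$; (2) for every $u\in P$ and every $v\in H(u)$, $\Phi(v)=\Phi(u)$; (3) for every $u\in P$ and every $g\in G$, $\Phi(ug)=I_{g^{-1}}(\Phi(u))=g^{-1}\Phi(u)\,g$, where $I_k(k')=kk'k^{-1}$. -/

import Mathlib

open scoped Manifold ContDiff

noncomputable section

universe uM uN uP uG uF

/-! ### Distributions, complete integrability and leaves

Manifolds are modelled on a (finite dimensional) real vector space `E`, hence are without boundary;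
smooth means `C^∞`. -/

section Distributions

variable {E : Type*} [NormedAddCommGroup E] [NormedSpace ℝ E]
  {B : Type uM} [TopologicalSpace B] [ChartedSpace E B] [IsManifold 𝓘(ℝ, E) ∞ B]

/-- A choice of a linear subspace of every tangent space (not necessarily of constant rank). -/
abbrev TangentDistribution (E : Type*) [NormedAddCommGroup E] [NormedSpace ℝ E]
    (B : Type uM) [TopologicalSpace B] [ChartedSpace E B] : Type _ :=
  (x : B) → Submodule ℝ (TangentSpace 𝓘(ℝ, E) x)

/-- `X` is a smooth vector field on the set `U`. -/
def IsSmoothFieldOn (U : Set B) (X : (x : B) → TangentSpace 𝓘(ℝ, E) x) : Prop :=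
  ContMDiffOn 𝓘(ℝ, E) 𝓘(ℝ, E).tangent ∞ (fun x => (⟨x, X x⟩ : TangentBundle 𝓘(ℝ, E) B)) U

/-- `F` is differentiable: every `F x` is spanned by the values at `x` of the smooth vector fields
on `B` that take their values in `F`. (As `F x` is finite dimensional, finitely many of them
suffice.) -/
def TangentDistribution.IsDifferentiable (F : TangentDistribution E B) : Prop :=
  ∀ x, F x = Submodule.span ℝ
    {w | ∃ X : (y : B) → TangentSpace 𝓘(ℝ, E) y,
      IsSmoothFieldOn Set.univ X ∧ (∀ y, X y ∈ F y) ∧ w = X x}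

/-- `S ⊆ B` is a connected immersed submanifold (the image of an injective immersion `i` of a
connected manifold `L`) with `T_y S = F_y` for all `y ∈ S`. The manifold `L` is
Hausdorff as soon as `B` is, and second countable as soon as `B` is moreover second countable. -/
def TangentDistribution.IsIntegralManifold (F : TangentDistribution E B) (S : Set B) : Prop :=
  ∃ (k : ℕ) (L : Type uM) (_ : TopologicalSpace L)
    (_ : ChartedSpace (EuclideanSpace ℝ (Fin k)) L) (_ : IsManifold (𝓡 k) ∞ L)
    (_ : ConnectedSpace L) (i : L → B),
    ContMDiff (𝓡 k) 𝓘(ℝ, E) ∞ i ∧ Function.Injective i ∧ Set.range i = S ∧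
    ∀ y : L, Function.Injective (mfderiv (𝓡 k) 𝓘(ℝ, E) i y) ∧
      Set.range (mfderiv (𝓡 k) 𝓘(ℝ, E) i y) = (F (i y) : Set (TangentSpace 𝓘(ℝ, E) (i y)))

/-- `F` is a completely integrable (differentiable) distribution. -/
def TangentDistribution.IsCompletelyIntegrable (F : TangentDistribution E B) : Prop :=
  F.IsDifferentiable ∧ ∀ x, ∃ S, x ∈ S ∧ F.IsIntegralManifold S

/-- `S` is a leaf of `F`: a maximal integral manifold. -/
def TangentDistribution.IsLeaf (F : TangentDistribution E B) (S : Set B) : Prop :=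
  F.IsIntegralManifold S ∧ ∀ S', F.IsIntegralManifold S' → S ⊆ S' → S' = S

/-- The leaf of `F` through `x`, as a set of points. (For a completely integrable `F` there is
exactly one leaf that contains `x`.) -/
def TangentDistribution.leafThrough (F : TangentDistribution E B) (x : B) : Set B :=
  {y | ∃ S, F.IsLeaf S ∧ x ∈ S ∧ y ∈ S}

open Classical in
/-- The smallest completely integrable distribution that contains `F`. For a distribution generated
by smooth local vector fields it exists (Sussmann); the value `⊥` in the other case is a mere
convention. -/
def TangentDistribution.integrableHull (F : TangentDistribution E B) : TangentDistribution E B :=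
  if hF : ∃ F' : TangentDistribution E B,
      IsLeast {K : TangentDistribution E B | K.IsCompletelyIntegrable ∧ F ≤ K} F'
  then hF.choose else ⊥

/-- The distribution generated by a family of local vector fields, each given by its domain and
its values. -/
def generatedDistribution (𝓕 : Set (Set B × ((x : B) → TangentSpace 𝓘(ℝ, E) x))) :
    TangentDistribution E B :=
  fun x => Submodule.span ℝ {w | ∃ X ∈ 𝓕, x ∈ X.1 ∧ w = X.2 x}

end Distributions

/-! ### Anchored bundles, principal bundles and principal lifts -/

section Bundles

variable (EM EN EP EG EF : Type*)
  [NormedAddCommGroup EM] [NormedSpace ℝ EM] [NormedAddCommGroup EN] [NormedSpace ℝ EN]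
  [NormedAddCommGroup EP] [NormedSpace ℝ EP] [NormedAddCommGroup EG] [NormedSpace ℝ EG]
  [NormedAddCommGroup EF] [NormedSpace ℝ EF]
  (M : Type uM) [TopologicalSpace M] [ChartedSpace EM M] [IsManifold 𝓘(ℝ, EM) ∞ M]
  (N : Type uN) [TopologicalSpace N] [ChartedSpace EN N] [IsManifold 𝓘(ℝ, EN) ∞ N]
  (P : Type uP) [TopologicalSpace P] [ChartedSpace EP P] [IsManifold 𝓘(ℝ, EP) ∞ P]
  (G : Type uG) [TopologicalSpace G] [ChartedSpace EG G] [Group G] [LieGroup 𝓘(ℝ, EG) ∞ G]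
  (F : Type uF) [TopologicalSpace F] [ChartedSpace EF F] [IsManifold 𝓘(ℝ, EF) ∞ F]

variable {EM EN EF M N F} in
/-- `φ` is a smooth local trivialisation, over the open set `U ⊆ M`, of the map `ν : N → M` with
typical fibre `F`: a diffeomorphism of `ν⁻¹(U)` onto `U × F` over `U`. -/
structure IsSmoothLocalTriv (ν : N → M) (U : Set M) (φ : OpenPartialHomeomorph N (M × F)) :
    Prop where
  isOpen : IsOpen U
  source_eq : φ.source = ν ⁻¹' U
  target_eq : φ.target = U ×ˢ Set.univ
  fst_eq : ∀ s ∈ φ.source, (φ s).1 = ν s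
  smooth : ContMDiffOn 𝓘(ℝ, EN) (𝓘(ℝ, EM).prod 𝓘(ℝ, EF)) ∞ φ φ.source
  smooth_symm : ContMDiffOn (𝓘(ℝ, EM).prod 𝓘(ℝ, EF)) 𝓘(ℝ, EN) ∞ φ.symm φ.target

/-- An anchored bundle `(ν, ρ)` on `M`: a smooth fibre bundle `ν : N → M` with typical fibre `F`,
and a smooth map `ρ : N → TM` fibred over the identity of `M`. -/
structure AnchoredBundle where
  /-- the projection -/
  ν : N → M
  smooth_ν : ContMDiff 𝓘(ℝ, EN) 𝓘(ℝ, EM) ∞ ν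
  locally_trivial : ∀ x : M, ∃ U, x ∈ U ∧ ∃ φ : OpenPartialHomeomorph N (M × F),
    IsSmoothLocalTriv (EM := EM) (EN := EN) (EF := EF) ν U φ
  /-- the anchor map -/
  ρ : (s : N) → TangentSpace 𝓘(ℝ, EM) (ν s)
  smooth_ρ : ContMDiff 𝓘(ℝ, EN) 𝓘(ℝ, EM).tangent ∞
    (fun s => (⟨ν s, ρ s⟩ : TangentBundle 𝓘(ℝ, EM) M))

/-- A principal fibre bundle `π : P → M` with structure group `G`: a smooth right action of `G`
on `P` together with equivariant local trivialisations of `π` with typical fibre `G`. -/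
structure PrincipalBundle where
  /-- the projection -/
  π : P → M
  smooth_π : ContMDiff 𝓘(ℝ, EP) 𝓘(ℝ, EM) ∞ π
  /-- the right action `(u, g) ↦ u g` -/
  act : P → G → P
  act_one : ∀ u, act u 1 = u
  act_mul : ∀ u g g', act u (g * g') = act (act u g) g'
  smooth_act : ContMDiff (𝓘(ℝ, EP).prod 𝓘(ℝ, EG)) 𝓘(ℝ, EP) ∞ (fun p : P × G => act p.1 p.2)
  π_act : ∀ u g, π (act u g) = π u
  locally_trivial : ∀ x : M, ∃ U, x ∈ U ∧ ∃ φ : OpenPartialHomeomorph P (M × G),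
    IsSmoothLocalTriv (EM := EM) (EN := EP) (EF := EG) π U φ ∧
    ∀ u ∈ φ.source, ∀ g, (φ (act u g)).2 = (φ u).2 * g

variable {EM EN EP EG EF M N P G F}

/-- A principal `ρ`-lift: a smooth map `h : π^*N → TP` over the identity of `P` such that
`TR_g (h (u, s)) = h (u g, s)` and `Tπ (h (u, s)) = ρ s`. Here `π^*N` is the submanifold
`{(u, s) | π u = ν s}` of `P × N`; the values of `h` outside of it are never used. -/
structure PrincipalLift (A : AnchoredBundle EM EN EF M N F) (B : PrincipalBundle EM EP EG M P G)
    where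
  /-- the lift -/
  h : (u : P) → N → TangentSpace 𝓘(ℝ, EP) u
  smooth_h : ContMDiffOn (𝓘(ℝ, EP).prod 𝓘(ℝ, EN)) 𝓘(ℝ, EP).tangent ∞
    (fun p : P × N => (⟨p.1, h p.1 p.2⟩ : TangentBundle 𝓘(ℝ, EP) P)) {p | B.π p.1 = A.ν p.2}
  equivariant : ∀ u s g, B.π u = A.ν s →
    tangentMap 𝓘(ℝ, EP) 𝓘(ℝ, EP) (fun v => B.act v g) ⟨u, h u s⟩ =
      (⟨B.act u g, h (B.act u g) s⟩ : TangentBundle 𝓘(ℝ, EP) P)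
  anchored : ∀ u s, B.π u = A.ν s →
    tangentMap 𝓘(ℝ, EP) 𝓘(ℝ, EM) B.π ⟨u, h u s⟩ =
      (⟨A.ν s, A.ρ s⟩ : TangentBundle 𝓘(ℝ, EM) M)

namespace PrincipalLift

variable {A : AnchoredBundle EM EN EF M N F} {B : PrincipalBundle EM EP EG M P G}

/-- The family of local vector fields `h ∘ σ` on `P`, for all smooth local sections
`u ↦ (u, σ u)` of `π^*N → P`. -/
def fieldFamily (h : PrincipalLift A B) :
    Set (Set P × ((u : P) → TangentSpace 𝓘(ℝ, EP) u)) :=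
  {X | IsOpen X.1 ∧ ∃ σ : P → N, ContMDiffOn 𝓘(ℝ, EP) 𝓘(ℝ, EN) ∞ σ X.1 ∧
    (∀ u ∈ X.1, B.π u = A.ν (σ u)) ∧ X.2 = fun u => h.h u (σ u)}

/-- The distribution `Q` on `P` generated by the lift. -/
def Q (h : PrincipalLift A B) : TangentDistribution EP P :=
  generatedDistribution h.fieldFamily

/-- `H(u)`: the leaf through `u` of the smallest completely integrable distribution containing
`Q`. -/
def leaf (h : PrincipalLift A B) (u : P) : Set P :=
  h.Q.integrableHull.leafThrough u

/-- `Φ(u)`: the set of all `g` in `G` with `u g ∈ H(u)`. -/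
def holonomy (h : PrincipalLift A B) (u : P) : Set G :=
  {g | B.act u g ∈ h.leaf u}

end PrincipalLift

end Bundles

end

/-! Right translations preserve `Q`: equivariance of the lift carries the field `h ∘ σ` to the field
of the translated section. Pulling back by a diffeomorphism preserves complete integrability, so
minimality makes the hull invariant under every `R_g`, and `R_g` permutes the leaves. If the leaves
partition `P`, then `g ∈ Φ(u)` means exactly that `ug` and `u` have the same leaf, and this relation
is stable under right translation; (1), (2) and (3) follow by algebra in `G`.

The analytic work is the partition: a distribution of varying rank that merely has an integral
manifold through each point must have exactly one leaf through each point. Parametrised pieces of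
integral manifolds are called plaques. By `IsPlaque.exists_transition`, plaques of the same
dimension that meet are related near the meeting point by a smooth change of parameters. The plaques
therefore form a smooth atlas on the set of points of rank `k`, usually with a finer topology than
that of the ambient manifold. A connected component of this space is the largest integral manifold
through each of its points. The overlap statement rests on a Gronwall estimate: the defect measuring
how far one plaque is from the other has derivative bounded by a multiple of itself, and vanishes at
the common point. -/

/-! ### Local uniqueness of integral manifolds in a vector space. -/

section Flat

open Set Filter Topology

variable {V E : Type*} [NormedAddCommGroup V] [NormedSpace ℝ V]
  [NormedAddCommGroup E] [NormedSpace ℝ E]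

/-- A Gronwall type statement: a function whose derivative is bounded by a multiple of the function
vanishes near each of its zeros. -/
theorem eventually_eq_zero_of_norm_fderiv_le {q : V → E} {b : V} {C : ℝ} (hb : q b = 0)
    (hd : ∀ᶠ p in 𝓝 b, DifferentiableAt ℝ q p)
    (hq : ∀ᶠ p in 𝓝 b, ‖fderiv ℝ q p‖ ≤ C * ‖q p‖) :
    ∀ᶠ p in 𝓝 b, q p = 0 := by
  obtain ⟨ε, hε, hball⟩ := Metric.eventually_nhds_iff_ball.1 (hd.and hq)
  -- Gronwall is applied along the segment from `b` to `p`. Radius at most 1 keeps the speed `‖p -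
  -- b‖` at most 1, so the bound on `fderiv` bounds the derivative along the segment.
  refine Metric.eventually_nhds_iff_ball.2 ⟨min ε 1, lt_min hε one_pos, fun p hp => ?_⟩
  have hC : 0 ≤ max C 0 := le_max_right _ _
  have hline : ∀ t ∈ Icc (0 : ℝ) 1, b + t • (p - b) ∈ Metric.ball b ε := by
    intro t ht
    have hp' : ‖p - b‖ < ε := by
      have := Metric.mem_ball.1 hp
      rw [dist_eq_norm] at this
      exact this.trans_le (min_le_left _ _)
    rw [Metric.mem_ball, dist_eq_norm, add_sub_cancel_left, norm_smul, Real.norm_of_nonneg ht.1]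
    exact (mul_le_of_le_one_left (norm_nonneg _) ht.2).trans_lt hp'
  have hp1 : ‖p - b‖ ≤ 1 := by
    have := Metric.mem_ball.1 hp
    rw [dist_eq_norm] at this
    exact (this.trans_le (min_le_right _ _)).le
  have hder : ∀ t ∈ Icc (0 : ℝ) 1, HasDerivAt (fun t : ℝ => q (b + t • (p - b)))
      (fderiv ℝ q (b + t • (p - b)) (p - b)) t := by
    intro t ht
    have h1 : HasDerivAt (fun t : ℝ => b + t • (p - b)) (p - b) t := by
      simpa using ((hasDerivAt_id t).smul_const (p - b)).const_add b
    exact (hball _ (hline t ht)).1.hasFDerivAt.comp_hasDerivAt t h1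
  have key := norm_le_gronwallBound_of_norm_deriv_right_le (a := 0) (b := 1) (δ := 0)
    (K := max C 0) (ε := 0)
    (fun t ht => (hder t ht).continuousAt.continuousWithinAt)
    (fun t ht => (hder t (Ico_subset_Icc_self ht)).hasDerivWithinAt)
    (by simp [hb]) (fun t ht => by
      rw [add_zero]
      have h1 := (hball _ (hline t (Ico_subset_Icc_self ht))).2
      calc _ ≤ ‖fderiv ℝ q (b + t • (p - b))‖ * ‖p - b‖ := ContinuousLinearMap.le_opNorm _ _
        _ ≤ ‖fderiv ℝ q (b + t • (p - b))‖ := mul_le_of_le_one_right (norm_nonneg _) hp1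
        _ ≤ C * ‖q (b + t • (p - b))‖ := h1
        _ ≤ _ := mul_le_mul_of_nonneg_right (le_max_left _ _) (norm_nonneg _)) 1 (by simp)
  simpa [gronwallBound_ε0] using key

/-- An immersion into a vector space has local left inverses. -/
theorem exists_contDiffAt_leftInverse [FiniteDimensional ℝ V] [FiniteDimensional ℝ E]
    {f : V → E} {a : V} (hf : ContDiffAt ℝ ∞ f a)
    (hinj : Function.Injective (fderiv ℝ f a)) :
    ∃ r : E → V, ContDiffAt ℝ ∞ r (f a) ∧ ∀ᶠ p in 𝓝 a, r (f p) = p := by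
  have : CompleteSpace V := FiniteDimensional.complete ℝ V
  -- A linear left inverse `l` of the differential makes `l ∘ f` have derivative the identity at
  -- `a`; its local inverse after `l` is the retraction.
  obtain ⟨l, hl⟩ := (fderiv ℝ f a : V →ₗ[ℝ] E).exists_leftInverse_of_injective
    (LinearMap.ker_eq_bot.2 hinj)
  let l' : E →L[ℝ] V := LinearMap.toContinuousLinearMap l
  have hll : l' ∘L fderiv ℝ f a = ContinuousLinearMap.id ℝ V := by
    ext v
    exact LinearMap.congr_fun hl v
  have hg : ContDiffAt ℝ ∞ (fun p => l' (f p)) a := l'.contDiff.contDiffAt.comp a hf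
  have hg' : HasFDerivAt (fun p => l' (f p))
      ((ContinuousLinearEquiv.refl ℝ V : V ≃L[ℝ] V) : V →L[ℝ] V) a := by
    have h1 := l'.hasFDerivAt.comp a (hf.differentiableAt (by simp)).hasFDerivAt
    rw [hll] at h1
    exact h1
  have hn : (∞ : WithTop ℕ∞) ≠ 0 := by simp
  refine ⟨fun z => hg.localInverse hg' hn (l' z), ?_, ?_⟩
  · exact (hg.to_localInverse hg' hn).comp (f a) l'.contDiff.contDiffAt
  · exact (hg.hasStrictFDerivAt' hg' hn).eventually_left_inverse

/-- Let `f` be an immersion and `A` a frame that is tangent to `f`. A map `g` that is tangent to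
the frame `A` and meets `f` factors locally through `f`. -/
theorem exists_factorization_of_tangent [FiniteDimensional ℝ V] [FiniteDimensional ℝ E]
    {f g : V → E} {a b : V} {A : E → V →L[ℝ] E} (hfg : f a = g b)
    (hf : ContDiffAt ℝ ∞ f a) (hg : ContDiffAt ℝ ∞ g b) (hA : ContDiffAt ℝ ∞ A (f a))
    (hinj : Function.Injective (fderiv ℝ f a)) (hAinj : Function.Injective (A (f a)))
    (h1 : ∀ᶠ p in 𝓝 a, ∀ w, ∃ v, fderiv ℝ f p v = A (f p) w)
    (h2 : ∀ᶠ p in 𝓝 b, ∀ v, ∃ w, A (g p) w = fderiv ℝ g p v) :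
    ∃ r : E → V, ContDiffAt ℝ ∞ r (f a) ∧ r (f a) = a ∧ ∀ᶠ p in 𝓝 b, f (r (g p)) = g p := by
  obtain ⟨r, hr, hrf⟩ := exists_contDiffAt_leftInverse hf hinj
  have hra : r (f a) = a := hrf.self_of_nhds
  refine ⟨r, hr, hra, ?_⟩
  have hfr : ContDiffAt ℝ ∞ f (r (f a)) := by rwa [hra]
  -- The defect: zero on the image of `f` near `f a`. The aim is to show that it vanishes along `g`.
  set Q : E → E := fun z => z - f (r z) with hQ
  have hQs : ContDiffAt ℝ ∞ Q (f a) := contDiffAt_id.sub (hfr.comp (f a) hr)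
  have hQf : ∀ᶠ p in 𝓝 a, Q (f p) = 0 := by
    filter_upwards [hrf] with p hp
    simp [hQ, hp]
  have hdQ : ∀ᶠ z in 𝓝 (f a), DifferentiableAt ℝ Q z :=
    ((hQs.of_le (m := 1) (by simp)).eventually (by simp)).mono
      fun z hz => hz.differentiableAt (by simp)
  have hdf : ∀ᶠ p in 𝓝 a, DifferentiableAt ℝ f p :=
    ((hf.of_le (m := 1) (by simp)).eventually (by simp)).mono
      fun z hz => hz.differentiableAt (by simp)
  have hdg : ∀ᶠ p in 𝓝 b, DifferentiableAt ℝ g p :=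
    ((hg.of_le (m := 1) (by simp)).eventually (by simp)).mono
      fun z hz => hz.differentiableAt (by simp)
  -- the transversal component of the frame
  set T : E → V →L[ℝ] E := fun z => (fderiv ℝ Q z) ∘L (A z) with hT
  have hTs : ContDiffAt ℝ 1 T (f a) :=
    (hQs.fderiv_right (m := 1) (by norm_cast)).clm_comp (hA.of_le (by simp))
  have hTf : ∀ᶠ p in 𝓝 a, T (f p) = 0 := by
    filter_upwards [hQf.eventually_nhds, h1, hdf, hf.continuousAt.eventually hdQ]
      with p hp hp1 hp2 hp3
    ext w
    obtain ⟨v, hv⟩ := hp1 w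
    have h0 : fderiv ℝ (Q ∘ f) p = 0 := by
      have : (Q ∘ f) =ᶠ[𝓝 p] fun _ => (0 : E) := hp
      rw [this.fderiv_eq]; simp
    rw [fderiv_comp p hp3 hp2] at h0
    simpa [hT, ← hv] using DFunLike.congr_fun h0 v
  obtain ⟨K, s, hs, hLip⟩ := hTs.exists_lipschitzOnWith
  have hrs : Tendsto (fun z => f (r z)) (𝓝 (f a)) (𝓝 (f a)) := by
    have := (hfr.comp (f a) hr).continuousAt
    rw [ContinuousAt, Function.comp_apply, hra] at this
    exact this
  have hrt : Tendsto r (𝓝 (f a)) (𝓝 a) := by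
    have := hr.continuousAt
    rwa [ContinuousAt, hra] at this
  -- Compare `z` with `f (r z)`: `T` vanishes at the latter point, and the distance between the two
  -- is `‖Q z‖`, so the Lipschitz bound gives the estimate.
  have hTQ : ∀ᶠ z in 𝓝 (f a), ‖T z‖ ≤ K * ‖Q z‖ := by
    filter_upwards [hs, hrs.eventually hs, hrt.eventually hTf] with z hz hz1 hz2
    have := hLip.norm_sub_le hz hz1
    rwa [hz2, sub_zero] at this
  -- the frame is uniformly injective near the base point
  obtain ⟨c, hc, hcA⟩ : ∃ c : ℝ, 0 ≤ c ∧ ∀ᶠ z in 𝓝 (f a), ∀ w, ‖w‖ ≤ c * ‖A z w‖ := by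
    obtain ⟨l, hl⟩ := (A (f a) : V →ₗ[ℝ] E).exists_leftInverse_of_injective
      (LinearMap.ker_eq_bot.2 hAinj)
    let l' : E →L[ℝ] V := LinearMap.toContinuousLinearMap l
    have hcont : ContinuousAt (fun z => ‖l'‖ * ‖A (f a) - A z‖) (f a) :=
      continuousAt_const.mul (continuousAt_const.sub hA.continuousAt).norm
    have hlt : ∀ᶠ z in 𝓝 (f a), ‖l'‖ * ‖A (f a) - A z‖ < 1 / 2 :=
      hcont.eventually_lt continuousAt_const (by simp)
    refine ⟨2 * ‖l'‖, by positivity, hlt.mono fun z hz w => ?_⟩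
    have e1 : w = l' (A z w) + l' ((A (f a) - A z) w) := by
      rw [← map_add]
      have : l' (A (f a) w) = w := LinearMap.congr_fun hl w
      simp [this]
    have e2 : ‖l' (A z w)‖ ≤ ‖l'‖ * ‖A z w‖ := l'.le_opNorm _
    have e3 : ‖l' ((A (f a) - A z) w)‖ ≤ ‖l'‖ * ‖A (f a) - A z‖ * ‖w‖ := by
      rw [mul_assoc]
      exact (l'.le_opNorm _).trans
        (mul_le_mul_of_nonneg_left (ContinuousLinearMap.le_opNorm _ _) (norm_nonneg _))
    have e4 : ‖w‖ ≤ ‖l' (A z w)‖ + ‖l' ((A (f a) - A z) w)‖ := by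
      conv_lhs => rw [e1]
      exact norm_add_le _ _
    have e5 : ‖l'‖ * ‖A (f a) - A z‖ * ‖w‖ ≤ 1 / 2 * ‖w‖ :=
      mul_le_mul_of_nonneg_right hz.le (norm_nonneg _)
    linarith
  have hgt : Tendsto g (𝓝 b) (𝓝 (f a)) := hfg ▸ hg.continuousAt
  have hD : ∀ᶠ p in 𝓝 b, ‖fderiv ℝ g p‖ < ‖fderiv ℝ g b‖ + 1 :=
    ((hg.fderiv_right (m := 1) (by norm_cast)).continuousAt.norm).eventually_lt
      continuousAt_const (by simp)
  -- As `fderiv g v` equals `A (g p) w` with `w` controlled by `v`, the derivative of `Q ∘ g` is `T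
  -- (g p) w`, hence at most a constant times `‖Q (g p)‖`.
  have hfin : ∀ᶠ p in 𝓝 b, (Q ∘ g) p = 0 := by
    refine eventually_eq_zero_of_norm_fderiv_le (C := K * c * (‖fderiv ℝ g b‖ + 1))
      ?_ ?_ ?_
    · simpa [← hfg] using hQf.self_of_nhds
    · filter_upwards [hdg, hgt.eventually hdQ] with p hp hp1 using hp1.comp p hp
    · filter_upwards [hdg, hgt.eventually hdQ, hD, hgt.eventually hcA, hgt.eventually hTQ, h2]
        with p hp hp1 hp2 hp3 hp4 hp5
      rw [fderiv_comp p hp1 hp]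
      refine ContinuousLinearMap.opNorm_le_bound _ (by positivity) fun v => ?_
      obtain ⟨w, hw⟩ := hp5 v
      have k1 : ‖fderiv ℝ g p v‖ ≤ (‖fderiv ℝ g b‖ + 1) * ‖v‖ :=
        (ContinuousLinearMap.le_opNorm _ _).trans
          (mul_le_mul_of_nonneg_right hp2.le (norm_nonneg _))
      calc ‖(fderiv ℝ Q (g p) ∘L fderiv ℝ g p) v‖ = ‖T (g p) w‖ := by simp [hT, hw]
        _ ≤ ‖T (g p)‖ * ‖w‖ := ContinuousLinearMap.le_opNorm _ _
        _ ≤ (K * ‖Q (g p)‖) * (c * ((‖fderiv ℝ g b‖ + 1) * ‖v‖)) := by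
          refine mul_le_mul hp4 ((hp3 w).trans ?_) (norm_nonneg _) (by positivity)
          rw [hw]
          exact mul_le_mul_of_nonneg_left k1 hc
        _ = _ := by simp only [Function.comp_apply]; ring
  filter_upwards [hfin] with p hp
  exact (sub_eq_zero.1 hp).symm

end Flat

/-! ### Plaques of a distribution and their overlaps. -/

section Plaques

open Set Filter Topology

variable {E : Type*} [NormedAddCommGroup E] [NormedSpace ℝ E]
  {B : Type uM} [TopologicalSpace B] [ChartedSpace E B]

/-- A plaque of the distribution `F`: an injective immersion `f` of the open set `U` of a Euclidean
space that is tangent to `F`. -/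
structure IsPlaque {k : ℕ} (F : TangentDistribution E B) (U : Set (EuclideanSpace ℝ (Fin k)))
    (f : EuclideanSpace ℝ (Fin k) → B) : Prop where
  isOpen : IsOpen U
  smooth : ContMDiffOn (𝓡 k) 𝓘(ℝ, E) ∞ f U
  injOn : InjOn f U
  mfderiv_injective : ∀ p ∈ U, Function.Injective (mfderiv (𝓡 k) 𝓘(ℝ, E) f p)
  range_mfderiv : ∀ p ∈ U, range (mfderiv (𝓡 k) 𝓘(ℝ, E) f p) =
    (F (f p) : Set (TangentSpace 𝓘(ℝ, E) (f p)))

/-- A smooth vector field in the coordinates given by the chart at `x₀`. -/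
noncomputable def fieldInChart (x₀ : B) (X : (x : B) → TangentSpace 𝓘(ℝ, E) x) (z : E) : E :=
  mfderiv 𝓘(ℝ, E) 𝓘(ℝ, E) (extChartAt 𝓘(ℝ, E) x₀) ((extChartAt 𝓘(ℝ, E) x₀).symm z)
    (X ((extChartAt 𝓘(ℝ, E) x₀).symm z))

theorem fieldInChart_extChartAt {x₀ x : B} (hx : x ∈ (extChartAt 𝓘(ℝ, E) x₀).source)
    (X : (x : B) → TangentSpace 𝓘(ℝ, E) x) :
    fieldInChart x₀ X (extChartAt 𝓘(ℝ, E) x₀ x) =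
      mfderiv 𝓘(ℝ, E) 𝓘(ℝ, E) (extChartAt 𝓘(ℝ, E) x₀) x (X x) := by
  have h : ∀ y, y = x → (mfderiv 𝓘(ℝ, E) 𝓘(ℝ, E) (extChartAt 𝓘(ℝ, E) x₀) y (X y) : E) =
      mfderiv 𝓘(ℝ, E) 𝓘(ℝ, E) (extChartAt 𝓘(ℝ, E) x₀) x (X x) := by
    rintro _ rfl; rfl
  exact h _ ((extChartAt 𝓘(ℝ, E) x₀).left_inv hx)

variable {k : ℕ} {F : TangentDistribution E B}

theorem IsPlaque.finrank_eq {U : Set (EuclideanSpace ℝ (Fin k))}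
    {f : EuclideanSpace ℝ (Fin k) → B} (hf : IsPlaque F U f) {a : EuclideanSpace ℝ (Fin k)}
    (ha : a ∈ U) : Module.finrank ℝ (F (f a)) = k := by
  have h1 : F (f a) = LinearMap.range (mfderiv (𝓡 k) 𝓘(ℝ, E) f a).toLinearMap :=
    SetLike.coe_injective (hf.range_mfderiv a ha).symm
  rw [h1, LinearMap.finrank_range_of_inj (hf.mfderiv_injective a ha)]
  exact finrank_euclideanSpace_fin

variable [IsManifold 𝓘(ℝ, E) ∞ B]

/-- On the chart domain the differential of the chart is the tangent bundle trivialisation, so the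
coordinate field is the trivialised section. -/
theorem contDiffAt_fieldInChart {x₀ : B} {X : (x : B) → TangentSpace 𝓘(ℝ, E) x}
    (hX : IsSmoothFieldOn univ X) :
    ContDiffAt ℝ ∞ (fieldInChart x₀ X) (extChartAt 𝓘(ℝ, E) x₀ x₀) := by
  have h1 := (Bundle.contMDiffAt_section (n := ∞) (IB := 𝓘(ℝ, E)) (F := E)
    (E := TangentSpace 𝓘(ℝ, E) (M := B)) (s := X) x₀).1
    ((contMDiffOn_univ.1 hX) x₀)
  have h2 : ContMDiffAt 𝓘(ℝ, E) 𝓘(ℝ, E) ∞ (extChartAt 𝓘(ℝ, E) x₀).symm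
      (extChartAt 𝓘(ℝ, E) x₀ x₀) :=
    (contMDiffOn_extChartAt_symm x₀).contMDiffAt (extChartAt_target_mem_nhds x₀)
  rw [← contMDiffAt_iff_contDiffAt]
  have h3 := ContMDiffAt.comp_of_eq (x := extChartAt 𝓘(ℝ, E) x₀ x₀) h1 h2
    (extChartAt_to_inv x₀)
  refine h3.congr_of_eventuallyEq ?_
  filter_upwards [extChartAt_target_mem_nhds x₀ (I := 𝓘(ℝ, E))] with z hz
  have hz' : (extChartAt 𝓘(ℝ, E) x₀).symm z ∈ (chartAt E x₀).source := by
    have := (extChartAt 𝓘(ℝ, E) x₀).map_target hz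
    rwa [extChartAt_source] at this
  have hz'' : (extChartAt 𝓘(ℝ, E) x₀).symm z ∈
      (trivializationAt E (TangentSpace 𝓘(ℝ, E) (M := B)) x₀).baseSet := by
    simpa using hz'
  rw [fieldInChart, ← TangentBundle.continuousLinearMapAt_trivializationAt hz']
  exact (congrFun (Bundle.Trivialization.coe_linearMapAt (R := ℝ)
    (trivializationAt E (TangentSpace 𝓘(ℝ, E) (M := B)) x₀) _) _).trans (if_pos hz'')

/-- A differentiable distribution contains smooth fields that form a basis at a given point. -/
theorem TangentDistribution.IsDifferentiable.exists_frame [FiniteDimensional ℝ E]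
    (hF : F.IsDifferentiable) {x₀ : B}
    (hk : Module.finrank ℝ (F x₀) = k) :
    ∃ X : Fin k → (x : B) → TangentSpace 𝓘(ℝ, E) x,
      (∀ i, IsSmoothFieldOn univ (X i)) ∧ (∀ i y, X i y ∈ F y) ∧
      LinearIndependent ℝ (fun i => X i x₀) := by
  have : FiniteDimensional ℝ (TangentSpace 𝓘(ℝ, E) x₀) := inferInstanceAs (FiniteDimensional ℝ E)
  rw [hF x₀] at hk
  subst hk
  obtain ⟨w, hw, -, hli⟩ := Submodule.exists_fun_fin_finrank_span_eq ℝ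
    {w | ∃ X : (y : B) → TangentSpace 𝓘(ℝ, E) y,
      IsSmoothFieldOn Set.univ X ∧ (∀ y, X y ∈ F y) ∧ w = X x₀}
  choose X hX hXF hXw using hw
  refine ⟨X, hX, hXF, ?_⟩
  have : (fun i => X i x₀) = w := funext fun i => (hXw i).symm
  rwa [this]

/-- Two plaques that meet at a point overlap smoothly near that point. -/
theorem IsPlaque.exists_transition [FiniteDimensional ℝ E] (hF : F.IsDifferentiable)
    {U U' : Set (EuclideanSpace ℝ (Fin k))} {f g : EuclideanSpace ℝ (Fin k) → B}
    (hf : IsPlaque F U f) (hg : IsPlaque F U' g) {a b : EuclideanSpace ℝ (Fin k)}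
    (ha : a ∈ U) (hb : b ∈ U') (hab : f a = g b) :
    ∃ j : EuclideanSpace ℝ (Fin k) → EuclideanSpace ℝ (Fin k),
      ContDiffAt ℝ ∞ j b ∧ j b = a ∧ ∀ᶠ p in 𝓝 b, f (j p) = g p := by
  obtain ⟨X, hX, hXF, hXli⟩ := hF.exists_frame (hf.finrank_eq ha)
  set e := extChartAt 𝓘(ℝ, E) (f a) with he
  have hsrc : e.source ∈ 𝓝 (f a) := extChartAt_source_mem_nhds (f a)
  have hfa : ∀ᶠ p in 𝓝 a, p ∈ U ∧ f p ∈ e.source := (hf.isOpen.eventually_mem ha).and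
    ((hf.smooth.contMDiffAt (hf.isOpen.mem_nhds ha)).continuousAt.eventually hsrc)
  have hgb : ∀ᶠ p in 𝓝 b, p ∈ U' ∧ g p ∈ e.source := (hg.isOpen.eventually_mem hb).and
    ((hg.smooth.contMDiffAt (hg.isOpen.mem_nhds hb)).continuousAt.eventually (hab ▸ hsrc))
  have hinv : ∀ {y}, y ∈ e.source →
      Function.Injective (mfderiv 𝓘(ℝ, E) 𝓘(ℝ, E) e y) := fun hy =>
    (isInvertible_mfderiv_extChartAt hy).injective
  let W (x : B) : EuclideanSpace ℝ (Fin k) →ₗ[ℝ] TangentSpace 𝓘(ℝ, E) x :=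
    ∑ i, (EuclideanSpace.proj (𝕜 := ℝ) i).toLinearMap.smulRight (X i x)
  have hW : ∀ x w, W x w = ∑ i, w i • X i x := fun x w => by simp [W]
  have hWF : ∀ x w, W x w ∈ F x := fun x w => by
    rw [hW]; exact Submodule.sum_mem _ fun i _ => Submodule.smul_mem _ _ (hXF i x)
  -- The frame in the chart at `f a`. Its fields lie in `F`, but off the plaques the rank of `F` may
  -- exceed `k`; the frame need only span `F` along `g`.
  let A : E → EuclideanSpace ℝ (Fin k) →L[ℝ] E := fun z =>
    ∑ i, (EuclideanSpace.proj (𝕜 := ℝ) i).smulRight (fieldInChart (f a) (X i) z)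
  have hA : ∀ {x}, x ∈ e.source → ∀ w, A (e x) w = mfderiv 𝓘(ℝ, E) 𝓘(ℝ, E) e x (W x w) := by
    intro x hx w
    rw [hW, map_sum]
    simp only [A, sum_apply, ContinuousLinearMap.smulRight_apply]
    refine Finset.sum_congr rfl fun i _ => ?_
    rw [fieldInChart_extChartAt hx, map_smul]
    rfl
  have hAs : ContDiffAt ℝ ∞ A (e (f a)) :=
    ContDiffAt.sum fun i _ => contDiffAt_const.smulRight (contDiffAt_fieldInChart (hX i))
  have hWinj : Function.Injective (W (f a)) := by
    rw [← LinearMap.ker_eq_bot, LinearMap.ker_eq_bot']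
    intro w hw
    rw [hW] at hw
    ext i
    exact Fintype.linearIndependent_iff.1 hXli _ hw i
  have hAinj : Function.Injective (A (e (f a))) := by
    have : (A (e (f a)) : EuclideanSpace ℝ (Fin k) → E) =
        mfderiv 𝓘(ℝ, E) 𝓘(ℝ, E) e (f a) ∘ W (f a) :=
      funext fun w => hA (mem_of_mem_nhds hsrc) w
    rw [this]
    exact (hinv (mem_of_mem_nhds hsrc)).comp hWinj
  have hder : ∀ {U : Set (EuclideanSpace ℝ (Fin k))} {f : EuclideanSpace ℝ (Fin k) → B},
      IsPlaque F U f → ∀ {p}, p ∈ U → f p ∈ e.source → ∀ v,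
      fderiv ℝ (fun p => e (f p)) p v =
        mfderiv 𝓘(ℝ, E) 𝓘(ℝ, E) e (f p) (mfderiv (𝓡 k) 𝓘(ℝ, E) f p v) := by
    intro U f hf p hp hpe v
    rw [← mfderiv_eq_fderiv]
    have h1 : MDifferentiableAt 𝓘(ℝ, E) 𝓘(ℝ, E) e (f p) :=
      mdifferentiableAt_extChartAt (by rwa [he, extChartAt_source] at hpe)
    have h2 : MDifferentiableAt (𝓡 k) 𝓘(ℝ, E) f p :=
      (hf.smooth.contMDiffAt (hf.isOpen.mem_nhds hp)).mdifferentiableAt (by simp)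
    exact DFunLike.congr_fun (mfderiv_comp p h1 h2) v
  have hsm : ∀ {U : Set (EuclideanSpace ℝ (Fin k))} {f : EuclideanSpace ℝ (Fin k) → B},
      IsPlaque F U f → ∀ {p}, p ∈ U → f p ∈ e.source →
      ContDiffAt ℝ ∞ (fun p => e (f p)) p := by
    intro U f hf p hp hpe
    rw [← contMDiffAt_iff_contDiffAt]
    exact (contMDiffAt_extChartAt' (by rwa [he, extChartAt_source] at hpe)).comp p
      (hf.smooth.contMDiffAt (hf.isOpen.mem_nhds hp))
  have hga : ContinuousAt (fun p => e (g p)) b :=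
    (hsm hg hb hgb.self_of_nhds.2).continuousAt
  have hAg : ∀ᶠ p in 𝓝 b, Function.Injective (A (e (g p))) := by
    have h1 : ContinuousAt A (e (g b)) := hab ▸ hAs.continuousAt
    have h2 : ContinuousAt (fun p => A (e (g p))) b :=
      ContinuousAt.comp (f := fun p => e (g p)) h1 hga
    exact h2.eventually (ContinuousLinearMap.isOpen_injective.mem_nhds
      (show Function.Injective (A (e (g b))) from hab ▸ hAinj))
  obtain ⟨r, hr, hra, hrg⟩ := exists_factorization_of_tangent
    (f := fun p => e (f p)) (g := fun p => e (g p)) (a := a) (b := b) (A := A)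
    (by simp only [hab]) (hsm hf ha hfa.self_of_nhds.2) (hsm hg hb hgb.self_of_nhds.2) hAs
    (by
      have : (fderiv ℝ (fun p => e (f p)) a : EuclideanSpace ℝ (Fin k) → E) =
          mfderiv 𝓘(ℝ, E) 𝓘(ℝ, E) e (f a) ∘ mfderiv (𝓡 k) 𝓘(ℝ, E) f a :=
        funext fun w => hder hf ha (mem_of_mem_nhds hsrc) w
      rw [this]
      exact (hinv (mem_of_mem_nhds hsrc)).comp (hf.mfderiv_injective a ha))
    hAinj
    (by
      filter_upwards [hfa] with p hp w
      have h1 : W (f p) w ∈ range (mfderiv (𝓡 k) 𝓘(ℝ, E) f p) := by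
        rw [hf.range_mfderiv p hp.1]; exact hWF _ _
      obtain ⟨v, hv⟩ := h1
      exact ⟨v, (hder hf hp.1 hp.2 v).trans ((congrArg _ hv).trans (hA hp.2 w).symm)⟩)
    (by
      -- Independence of the frame is an open condition, and `F` has rank exactly `k` along `g`, so
      -- a dimension count shows that the frame spans `F` there.
      filter_upwards [hgb, hAg] with p hp hp' v
      have h1 : LinearMap.range (W (g p)) = F (g p) := by
        have : FiniteDimensional ℝ (TangentSpace 𝓘(ℝ, E) (g p)) :=
          inferInstanceAs (FiniteDimensional ℝ E)
        refine Submodule.eq_of_le_of_finrank_eq ?_ ?_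
        · rintro _ ⟨w, rfl⟩; exact hWF _ _
        · rw [hg.finrank_eq hp.1, LinearMap.finrank_range_of_inj, finrank_euclideanSpace_fin]
          intro w w' hww
          exact hp' (by rw [hA hp.2, hA hp.2, hww])
      have h2 : mfderiv (𝓡 k) 𝓘(ℝ, E) g p v ∈ F (g p) := by
        have := mem_range_self (f := mfderiv (𝓡 k) 𝓘(ℝ, E) g p) v
        rwa [hg.range_mfderiv p hp.1] at this
      rw [← h1] at h2
      obtain ⟨w, hw⟩ := h2
      exact ⟨w, (hA hp.2 w).trans ((congrArg _ hw).trans (hder hg hp.1 hp.2 v).symm)⟩)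
  have hr' : ContDiffAt ℝ ∞ r (e (g b)) := hab ▸ hr
  have hrb : r (e (g b)) = a := hab ▸ hra
  refine ⟨fun p => r (e (g p)), hr'.comp b (hsm hg hb hgb.self_of_nhds.2), hrb, ?_⟩
  have ht : Tendsto (fun p => r (e (g p))) (𝓝 b) (𝓝 a) := by
    have := (hr'.comp b (hsm hg hb hgb.self_of_nhds.2)).continuousAt
    rwa [ContinuousAt, Function.comp_apply, hrb] at this
  filter_upwards [hrg, hgb, ht.eventually hfa] with p h1 h2 h3
  exact e.injOn h3.2 h2.2 h1

end Plaques

/-! ### The leaf topology, and existence and uniqueness of leaves. -/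

section LeafSpace

open Set Filter Topology

variable {E : Type*} [NormedAddCommGroup E] [NormedSpace ℝ E]
  {B : Type uM} [TopologicalSpace B] [ChartedSpace E B]

/-- Passing to a chart only precomposes the differential with a bijection, so injectivity and range
can be transferred between an immersion and its local expression. -/
theorem exists_mfderiv_eq_comp_bijective {k : ℕ} {L : Type*} [TopologicalSpace L]
    [ChartedSpace (EuclideanSpace ℝ (Fin k)) L] [IsManifold (𝓡 k) ∞ L] {i : L → B}
    (hi : ContMDiff (𝓡 k) 𝓘(ℝ, E) ∞ i) {y₀ y : L}
    (hy : y ∈ (chartAt (EuclideanSpace ℝ (Fin k)) y₀).source) :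
    ∃ D : EuclideanSpace ℝ (Fin k) → EuclideanSpace ℝ (Fin k), Function.Bijective D ∧
      (mfderiv (𝓡 k) 𝓘(ℝ, E) i y : EuclideanSpace ℝ (Fin k) → E) =
        (mfderiv (𝓡 k) 𝓘(ℝ, E) (i ∘ (chartAt (EuclideanSpace ℝ (Fin k)) y₀).symm)
          (chartAt (EuclideanSpace ℝ (Fin k)) y₀ y) : EuclideanSpace ℝ (Fin k) → E) ∘ D := by
  set c := chartAt (EuclideanSpace ℝ (Fin k)) y₀ with hc
  have hext : (extChartAt (𝓡 k) y₀ : L → EuclideanSpace ℝ (Fin k)) = c := by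
    ext1 z; simp [hc]
  refine ⟨mfderiv (𝓡 k) (𝓡 k) c y, ?_, ?_⟩
  · have := (isInvertible_mfderiv_extChartAt (I := 𝓡 k) (x := y₀) (y := y)
      (by rwa [extChartAt_source])).bijective
    rwa [hext] at this
  · have h1 : MDifferentiableAt (𝓡 k) (𝓡 k) c y :=
      ((contMDiffOn_chart (n := ∞)).contMDiffAt (c.open_source.mem_nhds hy)).mdifferentiableAt
        (by simp)
    have h2 : MDifferentiableAt (𝓡 k) 𝓘(ℝ, E) (i ∘ c.symm) (c y) := by
      have : ContMDiffAt (𝓡 k) (𝓡 k) ∞ c.symm (c y) :=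
        contMDiffOn_chart_symm.contMDiffAt (c.open_target.mem_nhds (c.map_source hy))
      exact ((hi _).comp (c y) this).mdifferentiableAt (by simp)
    have h3 : i =ᶠ[𝓝 y] (i ∘ c.symm) ∘ c := by
      filter_upwards [c.open_source.mem_nhds hy] with z hz
      simp [c.left_inv hz]
    have h4 := h3.mfderiv_eq (I := 𝓡 k) (I' := 𝓘(ℝ, E))
    rw [mfderiv_comp y h2 h1] at h4
    ext v
    exact DFunLike.congr_fun h4 v

variable {F : TangentDistribution E B}

/-- An immersed integral manifold is covered by plaques. -/
theorem isPlaque_comp_chartAt_symm {k : ℕ} {L : Type*} [TopologicalSpace L]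
    [ChartedSpace (EuclideanSpace ℝ (Fin k)) L] [IsManifold (𝓡 k) ∞ L] {i : L → B}
    (hi : ContMDiff (𝓡 k) 𝓘(ℝ, E) ∞ i) (hinj : Function.Injective i)
    (hder : ∀ y : L, Function.Injective (mfderiv (𝓡 k) 𝓘(ℝ, E) i y) ∧
      range (mfderiv (𝓡 k) 𝓘(ℝ, E) i y) = (F (i y) : Set (TangentSpace 𝓘(ℝ, E) (i y))))
    (y₀ : L) :
    IsPlaque F (chartAt (EuclideanSpace ℝ (Fin k)) y₀).target
      (i ∘ (chartAt (EuclideanSpace ℝ (Fin k)) y₀).symm) := by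
  set c := chartAt (EuclideanSpace ℝ (Fin k)) y₀ with hc
  have key : ∀ p ∈ c.target, ∃ D : EuclideanSpace ℝ (Fin k) → EuclideanSpace ℝ (Fin k),
      Function.Bijective D ∧
      (mfderiv (𝓡 k) 𝓘(ℝ, E) i (c.symm p) : EuclideanSpace ℝ (Fin k) → E) =
        (mfderiv (𝓡 k) 𝓘(ℝ, E) (i ∘ c.symm) p : EuclideanSpace ℝ (Fin k) → E) ∘ D := by
    intro p hp
    have := exists_mfderiv_eq_comp_bijective hi (c.map_target hp)
    rwa [c.right_inv hp] at this
  refine ⟨c.open_target, ?_, ?_, ?_, ?_⟩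
  · exact hi.comp_contMDiffOn contMDiffOn_chart_symm
  · exact hinj.comp_injOn c.symm.injOn
  · intro p hp
    obtain ⟨D, hD, h⟩ := key p hp
    have h1 := (hder (c.symm p)).1
    exact (Function.Injective.of_comp_iff' _ hD).1 (h ▸ h1)
  · intro p hp
    obtain ⟨D, hD, h⟩ := key p hp
    have h1 := (hder (c.symm p)).2
    refine Eq.trans ?_ h1
    exact (hD.surjective.range_comp _).symm.trans (congrArg range h).symm

variable [IsManifold 𝓘(ℝ, E) ∞ B]

/-- Every point lies on a plaque. -/
def TangentDistribution.HasPlaques (F : TangentDistribution E B) : Prop :=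
  ∀ x, ∃ (k : ℕ) (U : Set (EuclideanSpace ℝ (Fin k))) (f : EuclideanSpace ℝ (Fin k) → B),
    IsPlaque F U f ∧ ∃ a ∈ U, f a = x

/-- The set of points at which the distribution has rank `k`. It will be given the topology and the
smooth structure for which the plaques are charts. -/
@[nolint unusedArguments]
def LeafSpace {F : TangentDistribution E B} (_ : F.IsDifferentiable) (_ : F.HasPlaques) (k : ℕ) :
    Type uM :=
  {y : B // Module.finrank ℝ (F y) = k}

namespace LeafSpace

variable {hF : F.IsDifferentiable} {hP : F.HasPlaques} {k : ℕ}

/-- The inclusion of the points of rank `k`. -/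
def incl (x : LeafSpace hF hP k) : B := x.1

theorem incl_injective : Function.Injective (incl : LeafSpace hF hP k → B) :=
  Subtype.val_injective

variable (hF hP k) in
/-- The charts of the leaf space are the inverses of plaques. -/
def plaqueCharts : Set (PartialEquiv (LeafSpace hF hP k) (EuclideanSpace ℝ (Fin k))) :=
  {e | ∃ f, IsPlaque F e.target f ∧ ∀ p ∈ e.target, incl (e.symm p) = f p}

variable (hF hP) in
theorem exists_plaqueChart {U : Set (EuclideanSpace ℝ (Fin k))}
    {f : EuclideanSpace ℝ (Fin k) → B} (hf : IsPlaque F U f) (hU : U.Nonempty) :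
    ∃ e ∈ plaqueCharts hF hP k, e.target = U ∧ ∀ p ∈ U, incl (e.symm p) = f p := by
  classical
  obtain ⟨a, ha⟩ := hU
  let s : EuclideanSpace ℝ (Fin k) → LeafSpace hF hP k := fun p =>
    -- The value `f a` outside `U` is a mere default; it is where nonemptiness of `U` enters.
    if hp : p ∈ U then ⟨f p, hf.finrank_eq hp⟩ else ⟨f a, hf.finrank_eq ha⟩
  have hs : ∀ p ∈ U, incl (s p) = f p := fun p hp => by simp [s, hp, incl]
  have hinj : InjOn s U := fun p hp q hq hpq => hf.injOn hp hq (by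
    rw [← hs p hp, ← hs q hq, hpq])
  refine ⟨(hinj.toPartialEquiv).symm, ⟨f, hf, hs⟩, rfl, hs⟩

theorem exists_mem_plaqueChart (x : LeafSpace hF hP k) :
    ∃ e ∈ plaqueCharts hF hP k, x ∈ e.source := by
  -- A plaque has the dimension of the rank of `F` at its points, so the plaque through `x` has
  -- dimension `k`.
  obtain ⟨k', U, f, hf, a, ha, hax⟩ := hP x.1
  obtain rfl : k' = k := by rw [← hf.finrank_eq ha, hax, x.2]
  obtain ⟨e, he, rfl, hef⟩ := exists_plaqueChart hF hP hf ⟨a, ha⟩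
  have hx : e.symm a = x := incl_injective ((hef a ha).trans hax)
  exact ⟨e, he, hx ▸ e.map_target ha⟩

variable [FiniteDimensional ℝ E]

/-- The smooth change of parameters between meeting plaques yields at once that overlaps are open
and that chart changes are continuous and smooth. -/
theorem exists_chart_transition {e e' : PartialEquiv (LeafSpace hF hP k) (EuclideanSpace ℝ (Fin k))}
    (he : e ∈ plaqueCharts hF hP k) (he' : e' ∈ plaqueCharts hF hP k)
    {b : EuclideanSpace ℝ (Fin k)} (hb : b ∈ (e.symm.trans e').source) :
    ∃ j, ContDiffAt ℝ ∞ j b ∧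
      ∀ᶠ p in 𝓝 b, p ∈ (e.symm.trans e').source ∧ (e.symm.trans e') p = j p := by
  obtain ⟨g, hg, heg⟩ := he
  obtain ⟨f, hf, hef⟩ := he'
  rw [PartialEquiv.trans_source, PartialEquiv.symm_source] at hb
  have ha := e'.map_source hb.2
  obtain ⟨j, hj, hja, hjb⟩ := hf.exists_transition hF hg ha hb.1 (by
    rw [← hef _ ha, e'.left_inv hb.2, heg _ hb.1])
  have ht : Tendsto j (𝓝 b) (𝓝 (e' (e.symm b))) := by
    have := hj.continuousAt
    rwa [ContinuousAt, hja] at this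
  refine ⟨j, hj, ?_⟩
  filter_upwards [hjb, ht.eventually (hf.isOpen.mem_nhds ha), hg.isOpen.mem_nhds hb.1]
    with p h1 h2 h3
  have h4 : e.symm p = e'.symm (j p) := incl_injective (by rw [heg _ h3, hef _ h2, h1])
  refine ⟨⟨h3, ?_⟩, ?_⟩
  · show e.symm p ∈ e'.source
    rw [h4]; exact e'.map_target h2
  · show e' (e.symm p) = j p
    rw [h4]; exact e'.right_inv h2

variable (hF hP k) in
/-- The atlas of the leaf space. -/
noncomputable def core : ChartedSpaceCore (EuclideanSpace ℝ (Fin k)) (LeafSpace hF hP k) where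
  atlas := plaqueCharts hF hP k
  chartAt x := (exists_mem_plaqueChart x).choose
  mem_chart_source x := (exists_mem_plaqueChart x).choose_spec.2
  chart_mem_atlas x := (exists_mem_plaqueChart x).choose_spec.1
  open_source _ _ he he' := isOpen_iff_mem_nhds.2 fun _ hb =>
    let ⟨_, _, h⟩ := exists_chart_transition he he' hb
    h.mono fun _ h => h.1
  continuousOn_toFun _ _ he he' := fun _ hb =>
    let ⟨_, hj, h⟩ := exists_chart_transition he he' hb
    (hj.continuousAt.congr (h.mono fun _ h => h.2.symm)).continuousWithinAt

noncomputable instance : TopologicalSpace (LeafSpace hF hP k) := (core hF hP k).toTopologicalSpace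

noncomputable instance : ChartedSpace (EuclideanSpace ℝ (Fin k)) (LeafSpace hF hP k) :=
  (core hF hP k).toChartedSpace

theorem toPartialEquiv_mem_plaqueCharts
    {e : OpenPartialHomeomorph (LeafSpace hF hP k) (EuclideanSpace ℝ (Fin k))}
    (he : e ∈ atlas (EuclideanSpace ℝ (Fin k)) (LeafSpace hF hP k)) :
    e.toPartialEquiv ∈ plaqueCharts hF hP k := by
  obtain ⟨e', he'⟩ := mem_iUnion.1 he
  obtain ⟨h, h'⟩ := mem_iUnion.1 he'
  rw [mem_singleton_iff.1 h']
  exact h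

instance : IsManifold (𝓡 k) ∞ (LeafSpace hF hP k) := by
  refine isManifold_of_contDiffOn _ _ _ fun e e' he he' => ?_
  intro b hb
  obtain ⟨j, hj, h⟩ := exists_chart_transition (toPartialEquiv_mem_plaqueCharts he)
    (toPartialEquiv_mem_plaqueCharts he') (b := b) hb.1
  exact (hj.congr_of_eventuallyEq (h.mono fun _ h => h.2)).contDiffWithinAt

instance : LocallyConnectedSpace (LeafSpace hF hP k) :=
  ChartedSpace.locallyConnectedSpace (EuclideanSpace ℝ (Fin k)) _

theorem exists_plaque_chartAt (x : LeafSpace hF hP k) :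
    ∃ f, IsPlaque F (chartAt (EuclideanSpace ℝ (Fin k)) x).target f ∧
      ∀ p ∈ (chartAt (EuclideanSpace ℝ (Fin k)) x).target,
        incl ((chartAt (EuclideanSpace ℝ (Fin k)) x).symm p) = f p :=
  toPartialEquiv_mem_plaqueCharts (chart_mem_atlas _ x)

theorem contMDiff_incl : ContMDiff (𝓡 k) 𝓘(ℝ, E) ∞ (incl : LeafSpace hF hP k → B) := by
  intro x
  obtain ⟨f, hf, hxf⟩ := exists_plaque_chartAt x
  set c := chartAt (EuclideanSpace ℝ (Fin k)) x with hc
  have hx : x ∈ c.source := mem_chart_source _ x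
  have h1 : ContMDiffAt (𝓡 k) 𝓘(ℝ, E) ∞ f (c x) :=
    hf.smooth.contMDiffAt (hf.isOpen.mem_nhds (c.map_source hx))
  have h2 : ContMDiffAt (𝓡 k) (𝓡 k) ∞ c x := contMDiffOn_chart.contMDiffAt
    (c.open_source.mem_nhds hx)
  refine (h1.comp x h2).congr_of_eventuallyEq ?_
  filter_upwards [c.open_source.mem_nhds hx] with y hy
  rw [Function.comp_apply, ← hxf _ (c.map_source hy), c.left_inv hy]

end LeafSpace

theorem TangentDistribution.IsCompletelyIntegrable.hasPlaques (hF : F.IsCompletelyIntegrable) :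
    F.HasPlaques := by
  intro x
  obtain ⟨S, hxS, k, L, _, _, _, _, i, hi, hinj, rfl, hder⟩ := hF.2 x
  obtain ⟨y, rfl⟩ := hxS
  refine ⟨k, _, _, isPlaque_comp_chartAt_symm hi hinj hder y,
    chartAt (EuclideanSpace ℝ (Fin k)) y y, mem_chart_target _ y, ?_⟩
  simp

namespace LeafSpace

variable [FiniteDimensional ℝ E] {hF : F.IsDifferentiable} {hP : F.HasPlaques} {k : ℕ}

/-- A component of the leaf space is an integral manifold. -/
theorem isIntegralManifold_image_connectedComponent (x : LeafSpace hF hP k) :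
    F.IsIntegralManifold (incl '' connectedComponent x) := by
  let C : TopologicalSpace.Opens (LeafSpace hF hP k) :=
    -- The leaf space is locally Euclidean, hence locally connected, so the component is open and
    -- inherits the manifold structure.
    ⟨connectedComponent x, isOpen_connectedComponent⟩
  have hC : ConnectedSpace C := Subtype.connectedSpace isConnected_connectedComponent
  have hsm : ContMDiff (𝓡 k) 𝓘(ℝ, E) ∞ (fun y : C => incl y.1) :=
    contMDiff_incl.comp contMDiff_subtype_val
  refine ⟨k, C, inferInstance, inferInstance, inferInstance, hC, fun y => incl y.1, hsm,
    incl_injective.comp Subtype.val_injective, ?_, fun y => ?_⟩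
  · rw [image_eq_range]; rfl
  · obtain ⟨f, hf, hyf⟩ := exists_plaque_chartAt y.1
    set c := chartAt (EuclideanSpace ℝ (Fin k)) y.1 with hc
    have hp : c y.1 ∈ c.target := mem_chart_target _ y.1
    obtain ⟨D, hD, h⟩ := exists_mfderiv_eq_comp_bijective hsm (mem_chart_source _ y)
    have hev : ((fun y : C => incl y.1) ∘ (chartAt (EuclideanSpace ℝ (Fin k)) y).symm)
        =ᶠ[𝓝 (c y.1)] f := by
      filter_upwards [C.chartAt_subtype_val_symm_eventuallyEq (x := y)
        (H := EuclideanSpace ℝ (Fin k)), c.open_target.mem_nhds hp] with p h1 h2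
      rw [← hyf p h2, h1]
      rfl
    have h' : (mfderiv (𝓡 k) 𝓘(ℝ, E) (fun y : C => incl y.1) y : EuclideanSpace ℝ (Fin k) → E) =
        (mfderiv (𝓡 k) 𝓘(ℝ, E) f (c y.1) : EuclideanSpace ℝ (Fin k) → E) ∘ D := by
      rw [h]
      have h1 := hev.mfderiv_eq (I := 𝓡 k) (I' := 𝓘(ℝ, E))
      ext v
      exact DFunLike.congr_fun h1 (D v)
    have hfy : f (c y.1) = incl y.1 := by
      rw [← hyf _ hp, c.left_inv (mem_chart_source _ y.1)]
    constructor
    · have h1 := (hf.mfderiv_injective _ hp).comp hD.injective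
      exact h' ▸ h1
    · have h1 := hf.range_mfderiv _ hp
      have h2 : ∀ z, f (c y.1) = z → range (mfderiv (𝓡 k) 𝓘(ℝ, E) f (c y.1)) =
          (F z : Set (TangentSpace 𝓘(ℝ, E) z)) := by
        rintro _ rfl; exact h1
      refine Eq.trans ?_ (h2 _ hfy)
      exact (congrArg range h').trans (hD.surjective.range_comp _)

/-- Every plaque is a chart of the leaf space, in particular those cut out of `L` by its own charts.
Near `y` the lift is a chart of `L` followed by the inverse of such a plaque chart, hence continuous
for the finer topology. -/
theorem continuous_of_isIntegral {L : Type*} [TopologicalSpace L]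
    [ChartedSpace (EuclideanSpace ℝ (Fin k)) L] [IsManifold (𝓡 k) ∞ L] {i : L → B}
    (hi : ContMDiff (𝓡 k) 𝓘(ℝ, E) ∞ i) (hinj : Function.Injective i)
    (hder : ∀ y : L, Function.Injective (mfderiv (𝓡 k) 𝓘(ℝ, E) i y) ∧
      range (mfderiv (𝓡 k) 𝓘(ℝ, E) i y) = (F (i y) : Set (TangentSpace 𝓘(ℝ, E) (i y))))
    {i' : L → LeafSpace hF hP k} (hi' : ∀ y, incl (i' y) = i y) : Continuous i' := by
  refine continuous_iff_continuousAt.2 fun y => ?_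
  have hpl := isPlaque_comp_chartAt_symm hi hinj hder y
  set c := chartAt (EuclideanSpace ℝ (Fin k)) y with hc
  have hy : y ∈ c.source := mem_chart_source _ y
  obtain ⟨e, he, het, hef⟩ := exists_plaqueChart hF hP hpl ⟨c y, c.map_source hy⟩
  let e' := (core hF hP k).openPartialHomeomorph e he
  have h1 : ContinuousAt e.symm (c y) :=
    e'.symm.continuousAt (show c y ∈ e.target from het ▸ c.map_source hy)
  refine (h1.comp (c.continuousAt hy)).congr ?_
  filter_upwards [c.open_source.mem_nhds hy] with z hz
  refine incl_injective ?_
  rw [Function.comp_apply, hef _ (c.map_source hz), hi', Function.comp_apply, c.left_inv hz]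

/-- The rank at `x` fixes the dimension of the integral manifold; its continuous lift to the leaf
space is connected and so stays in one component. -/
theorem subset_image_connectedComponent (x : LeafSpace hF hP k) {S : Set B}
    (hS : F.IsIntegralManifold S) (hx : incl x ∈ S) : S ⊆ incl '' connectedComponent x := by
  obtain ⟨k', L, _, _, _, _, i, hi, hinj, rfl, hder⟩ := hS
  have hrank : ∀ y, Module.finrank ℝ (F (i y)) = k' := fun y => by
    have h1 : F (i y) = LinearMap.range (mfderiv (𝓡 k') 𝓘(ℝ, E) i y).toLinearMap :=
      SetLike.coe_injective (hder y).2.symm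
    rw [h1, LinearMap.finrank_range_of_inj (hder y).1]
    exact finrank_euclideanSpace_fin
  obtain ⟨y₀, hy₀⟩ := hx
  obtain rfl : k' = k := by rw [← hrank y₀, hy₀]; exact x.2
  let i' : L → LeafSpace hF hP k' := fun y => ⟨i y, hrank y⟩
  have hi' : Continuous i' := continuous_of_isIntegral hi hinj hder fun _ => rfl
  have hxi : i' y₀ = x := incl_injective hy₀
  rintro _ ⟨y, rfl⟩
  refine ⟨i' y, ?_, rfl⟩
  exact (isPreconnected_range hi').subset_connectedComponent ⟨y₀, hxi⟩ ⟨y, rfl⟩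

end LeafSpace

variable [FiniteDimensional ℝ E]

/-- Through every point there is a largest integral manifold. -/
theorem TangentDistribution.exists_largest_integralManifold (hF : F.IsDifferentiable)
    (hP : F.HasPlaques) (x : B) :
    ∃ S, x ∈ S ∧ F.IsIntegralManifold S ∧ ∀ S', F.IsIntegralManifold S' → x ∈ S' → S' ⊆ S := by
  let x' : LeafSpace hF hP (Module.finrank ℝ (F x)) := ⟨x, rfl⟩
  exact ⟨LeafSpace.incl '' connectedComponent x', ⟨x', mem_connectedComponent, rfl⟩,
    LeafSpace.isIntegralManifold_image_connectedComponent x',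
    fun S' hS' hx => LeafSpace.subset_image_connectedComponent x' hS' hx⟩

/-- The leaf through `x` is the unique leaf that contains `x`. -/
theorem TangentDistribution.leafThrough_spec (hF : F.IsDifferentiable) (hP : F.HasPlaques)
    (x : B) : x ∈ F.leafThrough x ∧ F.IsLeaf (F.leafThrough x) ∧
      ∀ S, F.IsLeaf S → x ∈ S → S = F.leafThrough x := by
  obtain ⟨S, hxS, hS, hmax⟩ := F.exists_largest_integralManifold hF hP x
  have hleaf : F.IsLeaf S := ⟨hS, fun S' hS' h => (hmax S' hS' (h hxS)).antisymm h⟩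
  have huniq : ∀ S', F.IsLeaf S' → x ∈ S' → S' = S := fun S' hS' hx =>
    (hS'.2 S hS (hmax S' hS'.1 hx)).symm
  have heq : F.leafThrough x = S := by
    ext y
    refine ⟨?_, fun hy => ⟨S, hleaf, hxS, hy⟩⟩
    rintro ⟨S', hS', hx, hy⟩
    exact huniq S' hS' hx ▸ hy
  rw [heq]
  exact ⟨hxS, hleaf, huniq⟩

theorem TangentDistribution.leafThrough_eq_of_mem (hF : F.IsDifferentiable) (hP : F.HasPlaques)
    {x y : B} (hy : y ∈ F.leafThrough x) : F.leafThrough y = F.leafThrough x :=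
  ((F.leafThrough_spec hF hP y).2.2 _ (F.leafThrough_spec hF hP x).2.1 hy).symm

end LeafSpace

/-! ### Diffeomorphisms acting on distributions, integral manifolds and leaves. -/

section Transport

open Set Filter Topology

variable {E : Type*} [NormedAddCommGroup E] [NormedSpace ℝ E]
  {B : Type uM} [TopologicalSpace B] [ChartedSpace E B]

/-- The pullback of a distribution by a diffeomorphism. -/
noncomputable def TangentDistribution.pullback (F : TangentDistribution E B) (φ : B ≃ₘ^∞⟮𝓘(ℝ, E), 𝓘(ℝ, E)⟯ B) :
    TangentDistribution E B :=
  fun x => (F (φ x)).comap (mfderiv 𝓘(ℝ, E) 𝓘(ℝ, E) φ x).toLinearMap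

theorem TangentDistribution.pullback_mono {F F' : TangentDistribution E B} (h : F ≤ F')
    (φ : B ≃ₘ^∞⟮𝓘(ℝ, E), 𝓘(ℝ, E)⟯ B) : F.pullback φ ≤ F'.pullback φ :=
  fun x => Submodule.comap_mono (h (φ x))

theorem Diffeomorph.mdifferentiableAt' (φ : B ≃ₘ^∞⟮𝓘(ℝ, E), 𝓘(ℝ, E)⟯ B) (x : B) :
    MDifferentiableAt 𝓘(ℝ, E) 𝓘(ℝ, E) φ x :=
  φ.mdifferentiable (by simp) x

theorem Diffeomorph.mfderiv_bijective (φ : B ≃ₘ^∞⟮𝓘(ℝ, E), 𝓘(ℝ, E)⟯ B) (x : B) :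
    Function.Bijective (mfderiv 𝓘(ℝ, E) 𝓘(ℝ, E) φ x) :=
  (φ.mfderivToContinuousLinearEquiv (by simp) x).bijective

theorem Diffeomorph.isInvertible_mfderiv (φ : B ≃ₘ^∞⟮𝓘(ℝ, E), 𝓘(ℝ, E)⟯ B) (x : B) :
    (mfderiv 𝓘(ℝ, E) 𝓘(ℝ, E) φ x).IsInvertible :=
  ⟨φ.mfderivToContinuousLinearEquiv (by simp) x, rfl⟩

@[simp]
theorem TangentDistribution.pullback_symm_pullback (F : TangentDistribution E B)
    (φ : B ≃ₘ^∞⟮𝓘(ℝ, E), 𝓘(ℝ, E)⟯ B) : (F.pullback φ.symm).pullback φ = F := by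
  funext x
  -- The base point is generalised because `φ.symm (φ x)` and `x` are only propositionally equal, so
  -- the two fibres of `F` have different types.
  have key : ∀ (y : B) (L : TangentSpace 𝓘(ℝ, E) x →L[ℝ] TangentSpace 𝓘(ℝ, E) y), y = x →
      (∀ w, (L w : E) = w) → (F y).comap L.toLinearMap = F x := by
    intro y L hy h
    subst hy
    ext w
    show L w ∈ F _ ↔ w ∈ F _
    rw [show L w = w from h w]
  refine key (φ.symm (φ x)) ((mfderiv 𝓘(ℝ, E) 𝓘(ℝ, E) φ.symm (φ x)).comp
    (mfderiv 𝓘(ℝ, E) 𝓘(ℝ, E) φ x)) (φ.symm_apply_apply x) fun w => ?_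
  have h1 : (φ.symm ∘ φ : B → B) = id := funext φ.symm_apply_apply
  have h2 := mfderiv_comp x (φ.symm.mdifferentiableAt' (φ x)) (φ.mdifferentiableAt' x)
  rw [h1, mfderiv_id] at h2
  exact (DFunLike.congr_fun h2 w).symm

/-- A diffeomorphism that preserves distributions maps integral manifolds to integral manifolds. -/
theorem TangentDistribution.IsIntegralManifold.image {F : TangentDistribution E B}
    {φ : B ≃ₘ^∞⟮𝓘(ℝ, E), 𝓘(ℝ, E)⟯ B} {S : Set B} (hS : (F.pullback φ).IsIntegralManifold S) :
    F.IsIntegralManifold (φ '' S) := by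
  obtain ⟨k, L, _, _, _, hL, i, hi, hinj, rfl, hder⟩ := hS
  have hcomp : ∀ y, mfderiv (𝓡 k) 𝓘(ℝ, E) (φ ∘ i) y =
      (mfderiv 𝓘(ℝ, E) 𝓘(ℝ, E) φ (i y)).comp (mfderiv (𝓡 k) 𝓘(ℝ, E) i y) := fun y =>
    mfderiv_comp y (φ.mdifferentiableAt' _) (hi.mdifferentiable (by simp) y)
  refine ⟨k, L, inferInstance, inferInstance, inferInstance, hL, φ ∘ i, φ.contMDiff.comp hi,
    φ.injective.comp hinj, range_comp _ _, fun y => ⟨?_, ?_⟩⟩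
  · rw [hcomp]
    exact (φ.mfderiv_bijective (i y)).1.comp (hder y).1
  · rw [hcomp]
    refine (range_comp (mfderiv 𝓘(ℝ, E) 𝓘(ℝ, E) φ (i y))
      (mfderiv (𝓡 k) 𝓘(ℝ, E) i y)).trans ?_
    rw [(hder y).2]
    exact image_preimage_eq _ (φ.mfderiv_bijective (i y)).2

variable {F : TangentDistribution E B} {φ : B ≃ₘ^∞⟮𝓘(ℝ, E), 𝓘(ℝ, E)⟯ B}

theorem TangentDistribution.pullback_symm_eq (h : F.pullback φ = F) : F.pullback φ.symm = F := by
  conv_lhs => rw [← h]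
  exact F.pullback_symm_pullback φ.symm

theorem TangentDistribution.IsLeaf.image (h : F.pullback φ = F) {S : Set B} (hS : F.IsLeaf S) :
    F.IsLeaf (φ '' S) := by
  refine ⟨IsIntegralManifold.image (h.symm ▸ hS.1), fun S' hS' hsub => ?_⟩
  have h1 : F.IsIntegralManifold (φ.symm '' S') :=
    IsIntegralManifold.image ((pullback_symm_eq h).symm ▸ hS')
  have h2 := hS.2 _ h1 (by
    rintro x hx
    exact ⟨φ x, hsub ⟨x, hx, rfl⟩, φ.symm_apply_apply x⟩)
  rw [← h2, image_image]
  simp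

theorem TangentDistribution.mem_leafThrough_apply (h : F.pullback φ = F) {x y : B}
    (hy : y ∈ F.leafThrough x) : φ y ∈ F.leafThrough (φ x) := by
  obtain ⟨S, hS, hx, hy⟩ := hy
  exact ⟨φ '' S, hS.image h, mem_image_of_mem _ hx, mem_image_of_mem _ hy⟩

/-- Points are plaques of dimension 0. This serves the default value of `integrableHull`. -/
theorem TangentDistribution.hasPlaques_bot : (⊥ : TangentDistribution E B).HasPlaques := by
  refine fun x => ⟨0, univ, fun _ => x, ⟨isOpen_univ, contMDiffOn_const,
    fun _ _ _ _ _ => Subsingleton.elim _ _, fun p _ => ?_, fun p _ => ?_⟩, 0, mem_univ _, rfl⟩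
  · have : Subsingleton (TangentSpace (𝓡 0) p) :=
      inferInstanceAs (Subsingleton (EuclideanSpace ℝ (Fin 0)))
    exact Function.injective_of_subsingleton _
  · rw [mfderiv_const]
    exact range_const

variable [IsManifold 𝓘(ℝ, E) ∞ B]

theorem TangentDistribution.IsDifferentiable.pullback [CompleteSpace E]
    (hF : F.IsDifferentiable) (φ : B ≃ₘ^∞⟮𝓘(ℝ, E), 𝓘(ℝ, E)⟯ B) :
    (F.pullback φ).IsDifferentiable := by
  intro x
  refine le_antisymm (fun w hw => ?_) (Submodule.span_le.2 ?_)
  · set T := {w | ∃ X : (y : B) → TangentSpace 𝓘(ℝ, E) y,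
      IsSmoothFieldOn Set.univ X ∧ (∀ y, X y ∈ F.pullback φ y) ∧ w = X x} with hT
    -- Fields of `F` that span at `φ x` are pulled back to smooth fields in the pulled back
    -- distribution; applying the inverse differential to `dφ w` then recovers `w`.
    have h1 : F (φ x) ≤
        (Submodule.span ℝ T).comap (mfderiv 𝓘(ℝ, E) 𝓘(ℝ, E) φ x).inverse.toLinearMap := by
      rw [hF (φ x), Submodule.span_le]
      rintro _ ⟨X, hX, hXF, rfl⟩
      refine Submodule.subset_span ⟨VectorField.mpullback 𝓘(ℝ, E) 𝓘(ℝ, E) φ X, ?_, ?_, rfl⟩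
      · exact contMDiffOn_univ.2 ((contMDiffOn_univ.1 hX).mpullback_vectorField φ.contMDiff
          φ.isInvertible_mfderiv (by simp))
      · intro y
        have h2 : mfderiv 𝓘(ℝ, E) 𝓘(ℝ, E) φ y
            (VectorField.mpullback 𝓘(ℝ, E) 𝓘(ℝ, E) φ X y) = X (φ y) :=
          (φ.isInvertible_mfderiv y).self_apply_inverse _
        show mfderiv 𝓘(ℝ, E) 𝓘(ℝ, E) φ y _ ∈ F (φ y)
        rw [h2]
        exact hXF _
    have h2 := h1 hw
    have h3 : (mfderiv 𝓘(ℝ, E) 𝓘(ℝ, E) φ x).inverse (mfderiv 𝓘(ℝ, E) 𝓘(ℝ, E) φ x w) = w :=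
      (φ.isInvertible_mfderiv x).inverse_apply_self _
    exact h3 ▸ h2
  · rintro _ ⟨X, -, hXF, rfl⟩
    exact hXF x

theorem TangentDistribution.IsCompletelyIntegrable.pullback [CompleteSpace E]
    (hF : F.IsCompletelyIntegrable) (φ : B ≃ₘ^∞⟮𝓘(ℝ, E), 𝓘(ℝ, E)⟯ B) :
    (F.pullback φ).IsCompletelyIntegrable := by
  refine ⟨hF.1.pullback φ, fun x => ?_⟩
  obtain ⟨S, hx, hS⟩ := hF.2 (φ x)
  refine ⟨φ.symm '' S, ⟨φ x, hx, φ.symm_apply_apply x⟩, ?_⟩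
  refine IsIntegralManifold.image (φ := φ.symm) ?_
  rwa [show (F.pullback φ).pullback φ.symm = F from F.pullback_symm_pullback φ.symm]

/-! ### The smallest completely integrable distribution -/

theorem TangentDistribution.isDifferentiable_bot :
    (⊥ : TangentDistribution E B).IsDifferentiable := by
  refine fun x => (Submodule.span_eq_bot.2 ?_).symm
  rintro _ ⟨X, -, hX, rfl⟩
  exact hX x

/-- Both branches of the definition are treated here and in the next results, since `⊥` has the
needed properties too; Sussmann's theorem is therefore not invoked. -/
theorem TangentDistribution.integrableHull_isDifferentiable (F : TangentDistribution E B) :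
    F.integrableHull.IsDifferentiable := by
  rw [integrableHull]
  split_ifs with h
  · exact h.choose_spec.1.1.1
  · exact isDifferentiable_bot

theorem TangentDistribution.integrableHull_hasPlaques (F : TangentDistribution E B) :
    F.integrableHull.HasPlaques := by
  rw [integrableHull]
  split_ifs with h
  · exact h.choose_spec.1.1.hasPlaques
  · exact hasPlaques_bot

/-- The pullback of the hull is again completely integrable and contains `F`, so minimality applies.
-/
theorem TangentDistribution.integrableHull_le_pullback [CompleteSpace E]
    (h : F ≤ F.pullback φ) : F.integrableHull ≤ F.integrableHull.pullback φ := by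
  rw [integrableHull]
  split_ifs with hF
  · exact hF.choose_spec.2 ⟨hF.choose_spec.1.1.pullback φ,
      h.trans (pullback_mono hF.choose_spec.1.2 φ)⟩
  · exact bot_le

/-- The smallest completely integrable distribution inherits the symmetries of the distribution. -/
theorem TangentDistribution.integrableHull_pullback [CompleteSpace E]
    (h : F ≤ F.pullback φ) (h' : F ≤ F.pullback φ.symm) :
    F.integrableHull.pullback φ = F.integrableHull :=
  ((pullback_mono (integrableHull_le_pullback h') φ).trans_eq
    (pullback_symm_pullback _ φ)).antisymm (integrableHull_le_pullback h)

end Transport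

/-! ### Invariance of the leaves under the structure group and the holonomy groups. -/

section Holonomy

variable {EM EN EP EG EF : Type*}
  [NormedAddCommGroup EM] [NormedSpace ℝ EM] [NormedAddCommGroup EN] [NormedSpace ℝ EN]
  [NormedAddCommGroup EP] [NormedSpace ℝ EP] [NormedAddCommGroup EG] [NormedSpace ℝ EG]
  [NormedAddCommGroup EF] [NormedSpace ℝ EF]
  {M : Type uM} [TopologicalSpace M] [ChartedSpace EM M]
  {N : Type uN} [TopologicalSpace N] [ChartedSpace EN N]
  {P : Type uP} [TopologicalSpace P] [ChartedSpace EP P]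
  {G : Type uG} [TopologicalSpace G] [ChartedSpace EG G] [Group G]
  {F : Type uF} [TopologicalSpace F] [ChartedSpace EF F]

/-- The right action of an element of the structure group as a diffeomorphism. -/
noncomputable def PrincipalBundle.actDiffeo (B : PrincipalBundle EM EP EG M P G) (g : G) :
    P ≃ₘ^∞⟮𝓘(ℝ, EP), 𝓘(ℝ, EP)⟯ P where
  toFun u := B.act u g
  invFun u := B.act u g⁻¹
  left_inv u := by simp only [← B.act_mul, mul_inv_cancel, B.act_one]
  right_inv u := by simp only [← B.act_mul, inv_mul_cancel, B.act_one]
  contMDiff_toFun := B.smooth_act.comp (contMDiff_id.prodMk contMDiff_const)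
  contMDiff_invFun := B.smooth_act.comp (contMDiff_id.prodMk contMDiff_const)

theorem PrincipalBundle.actDiffeo_symm (B : PrincipalBundle EM EP EG M P G) (g : G) :
    (B.actDiffeo g).symm = B.actDiffeo g⁻¹ :=
  Diffeomorph.ext fun _ => rfl

namespace PrincipalLift

variable [IsManifold 𝓘(ℝ, EM) ∞ M] [IsManifold 𝓘(ℝ, EP) ∞ P]
  {A : AnchoredBundle EM EN EF M N F} {B : PrincipalBundle EM EP EG M P G}

theorem Q_le_pullback (h : PrincipalLift A B) (g : G) : h.Q ≤ h.Q.pullback (B.actDiffeo g) := by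
  intro u
  refine Submodule.span_le.2 ?_
  rintro _ ⟨⟨W, X⟩, ⟨hW, σ, hσ, hπ, rfl⟩, hu, rfl⟩
  have h1 : mfderiv 𝓘(ℝ, EP) 𝓘(ℝ, EP) (B.actDiffeo g) u (h.h u (σ u)) =
      h.h (B.act u g) (σ u) :=
    eq_of_heq (Bundle.TotalSpace.mk.inj (h.equivariant u (σ u) g (hπ u hu))).2
  show mfderiv 𝓘(ℝ, EP) 𝓘(ℝ, EP) (B.actDiffeo g) u (h.h u (σ u)) ∈ h.Q (B.act u g)
  rw [h1]
  have hsymm : ContMDiff 𝓘(ℝ, EP) 𝓘(ℝ, EP) ∞ (fun v => B.act v g⁻¹) :=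
    (B.actDiffeo g⁻¹).contMDiff
  have hinv : B.act (B.act u g) g⁻¹ = u := (B.actDiffeo g).symm_apply_apply u
  -- The witness is the section `v ↦ σ (v g⁻¹)` on the translate `W g`; it still lies over `π`
  -- because the action preserves fibres.
  refine Submodule.subset_span ⟨((fun v => B.act v g⁻¹) ⁻¹' W,
    fun v => h.h v (σ (B.act v g⁻¹))), ⟨hW.preimage hsymm.continuous,
    fun v => σ (B.act v g⁻¹), hσ.comp hsymm.contMDiffOn fun _ hv => hv, fun v hv => ?_, rfl⟩,
    ?_, ?_⟩
  · rw [← hπ _ hv, B.π_act]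
  · show B.act (B.act u g) g⁻¹ ∈ W
    rwa [hinv]
  · show h.h (B.act u g) (σ u) = h.h (B.act u g) (σ (B.act (B.act u g) g⁻¹))
    rw [hinv]

variable [FiniteDimensional ℝ EP]

theorem integrableHull_pullback_actDiffeo (h : PrincipalLift A B) (g : G) :
    h.Q.integrableHull.pullback (B.actDiffeo g) = h.Q.integrableHull := by
  have : CompleteSpace EP := FiniteDimensional.complete ℝ EP
  refine TangentDistribution.integrableHull_pullback (h.Q_le_pullback g) ?_
  rw [B.actDiffeo_symm]
  exact h.Q_le_pullback g⁻¹

theorem mem_leaf_self (h : PrincipalLift A B) (u : P) : u ∈ h.leaf u :=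
  (TangentDistribution.leafThrough_spec h.Q.integrableHull_isDifferentiable
    h.Q.integrableHull_hasPlaques u).1

theorem leaf_eq_of_mem (h : PrincipalLift A B) {u v : P} (hv : v ∈ h.leaf u) :
    h.leaf v = h.leaf u :=
  TangentDistribution.leafThrough_eq_of_mem h.Q.integrableHull_isDifferentiable
    h.Q.integrableHull_hasPlaques hv

theorem leaf_act_eq (h : PrincipalLift A B) {u v : P} (huv : h.leaf v = h.leaf u) (g : G) :
    h.leaf (B.act v g) = h.leaf (B.act u g) :=
  h.leaf_eq_of_mem (TangentDistribution.mem_leafThrough_apply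
    (h.integrableHull_pullback_actDiffeo g)
    (show v ∈ h.leaf u from huv ▸ h.mem_leaf_self v))

/-- As leaves partition `P`, membership becomes an equality of leaves, which can be translated by
`leaf_act_eq`. -/
theorem mem_holonomy_iff (h : PrincipalLift A B) {u : P} {g : G} :
    g ∈ h.holonomy u ↔ h.leaf (B.act u g) = h.leaf u :=
  ⟨h.leaf_eq_of_mem, fun hg =>
    show B.act u g ∈ h.leaf u from hg ▸ h.mem_leaf_self (B.act u g)⟩

/-- The holonomy group at a point. -/
def holonomyGroup (h : PrincipalLift A B) (u : P) : Subgroup G where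
  carrier := h.holonomy u
  one_mem' := h.mem_holonomy_iff.2 (by rw [B.act_one])
  mul_mem' {g k} hg hk := h.mem_holonomy_iff.2 (by
    rw [B.act_mul, h.leaf_act_eq (h.mem_holonomy_iff.1 hg), h.mem_holonomy_iff.1 hk])
  inv_mem' {g} hg := h.mem_holonomy_iff.2 (by
    -- Translating the equality of the leaves of `ug` and `u` by `g⁻¹` gives that of the leaves of
    -- `u` and `u g⁻¹`.
    rw [← h.leaf_act_eq (h.mem_holonomy_iff.1 hg), ← B.act_mul, mul_inv_cancel, B.act_one])

theorem holonomy_eq_of_mem_leaf (h : PrincipalLift A B) {u v : P} (hv : v ∈ h.leaf u) :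
    h.holonomy v = h.holonomy u := by
  ext g
  rw [h.mem_holonomy_iff, h.mem_holonomy_iff, h.leaf_act_eq (h.leaf_eq_of_mem hv),
    h.leaf_eq_of_mem hv]

/-- Translating by `g⁻¹` moves `(ug)k` to `u(g k g⁻¹)` and `ug` to `u`; translating by `g` goes
back. -/
theorem mem_holonomy_act_iff (h : PrincipalLift A B) {u : P} {g k : G} :
    k ∈ h.holonomy (B.act u g) ↔ g * k * g⁻¹ ∈ h.holonomy u := by
  rw [h.mem_holonomy_iff, h.mem_holonomy_iff]
  constructor <;> intro hk
  · have := h.leaf_act_eq hk g⁻¹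
    rwa [← B.act_mul, ← B.act_mul, ← B.act_mul, mul_inv_cancel, B.act_one, ← mul_assoc] at this
  · have := h.leaf_act_eq hk g
    rwa [← B.act_mul, inv_mul_cancel_right, B.act_mul] at this

end PrincipalLift

end Holonomy

theorem mainTheorem10
    {EM EN EP EG EF : Type*}
    [NormedAddCommGroup EM] [NormedSpace ℝ EM] [FiniteDimensional ℝ EM]
    [NormedAddCommGroup EN] [NormedSpace ℝ EN] [FiniteDimensional ℝ EN]
    [NormedAddCommGroup EP] [NormedSpace ℝ EP] [FiniteDimensional ℝ EP]
    [NormedAddCommGroup EG] [NormedSpace ℝ EG] [FiniteDimensional ℝ EG]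
    [NormedAddCommGroup EF] [NormedSpace ℝ EF] [FiniteDimensional ℝ EF]
    {M : Type*} [TopologicalSpace M] [ChartedSpace EM M] [IsManifold 𝓘(ℝ, EM) ∞ M]
    [T2Space M] [SecondCountableTopology M]
    {N : Type*} [TopologicalSpace N] [ChartedSpace EN N] [IsManifold 𝓘(ℝ, EN) ∞ N]
    [T2Space N] [SecondCountableTopology N]
    {P : Type*} [TopologicalSpace P] [ChartedSpace EP P] [IsManifold 𝓘(ℝ, EP) ∞ P]
    [T2Space P] [SecondCountableTopology P]
    {G : Type*} [TopologicalSpace G] [ChartedSpace EG G] [Group G] [LieGroup 𝓘(ℝ, EG) ∞ G]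
    [T2Space G] [SecondCountableTopology G]
    {F : Type*} [TopologicalSpace F] [ChartedSpace EF F] [IsManifold 𝓘(ℝ, EF) ∞ F]
    [T2Space F] [SecondCountableTopology F]
    (A : AnchoredBundle EM EN EF M N F) (B : PrincipalBundle EM EP EG M P G)
    (h : PrincipalLift A B) :
    (∀ u : P, ∃ K : Subgroup G, (K : Set G) = h.holonomy u) ∧
    (∀ u : P, ∀ v ∈ h.leaf u, h.holonomy v = h.holonomy u) ∧
    (∀ (u : P) (g : G), h.holonomy (B.act u g) = (fun k => g⁻¹ * k * g) '' h.holonomy u) :=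
  ⟨fun u => ⟨h.holonomyGroup u, rfl⟩, fun _ _ hv => h.holonomy_eq_of_mem_leaf hv, fun u g => by
    ext k
    rw [h.mem_holonomy_act_iff]
    refine ⟨fun hk => ⟨_, hk, by group⟩, ?_⟩
    rintro ⟨k, hk, rfl⟩
    simpa [mul_assoc] using hk⟩
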